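/- Let $\mathbb D=\{z\in\mathbb C: |z|<1\}$. Let $\mathcal T$ be the set of all holomorphic $f:\mathbb D\to\mathbb D$ with $f(0)=0$ and $f'(0)>0$ that are typically real, i.e. $\operatorname{Im}(f(z))\operatorname{Im}(z)\ge 0$ for all $z\in\mathbb D$. Let $\mathcal U$ be the set of all injective holomorphic $f:\mathbb D\to\mathbb D$ with $f(0)=0$ and $f'(0)>0$ all of whose Taylor coefficients at $0$ are real. For a class $A$ of functions on $\mathbb D$ and $z_0\in\mathbb D$ put $V_A(z_0)=\{f(z_0): f\in A\}$. For $t\in[0,\infty)$ and $z\in\mathbb D$ let $$f_{1,t}(z)=\frac1{2z}\Bigl(e^t(z+1)^2-2z-e^{t/2}(z+1)\sqrt{e^t(z+1)^2-4z}\Bigr),$$ $$f_{2,t}(z)=\frac1{2z}\Bigl(e^t(z-1)^2+2z+e^{t/2}(z-1)\sqrt{e^t(z-1)^2+4z}\Bigr),$$ with the principal branch of the square root (the radicands do not meet $(-\infty,0]$ on $\mathbb D$) and with $f_{1,t}(0)=f_{2,t}(0)=0$ (removable singularity). Let $z_0\in\mathbb D\setminus\{0\}$. Then $V_{\mathcal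 T}(z_0)=V_{\mathcal U}(z_0)$. Furthermore, if $z_0\notin\mathbb R$, then for every $w\in\partial V_{\mathcal T}(z_0)\setminus\{0\}$ there is exactly one $f\in\mathcal T$ with $f(z_0)=w$, and this $f$ equals $f_{1,t}$ or $f_{2,t}$ for some $t\in[0,\infty)$. -/

import Mathlib

noncomputable section

/-- The open unit disc. -/
def unitDisc : Set ℂ := Metric.ball (0 : ℂ) 1

/-- Holomorphic self-maps of the unit disc with `f 0 = 0` and `f'(0)` real and positive.
Only the values on the disc matter: a function on `ℂ` stands for its restriction to the disc. -/
structure IsNormalizedSelfMap (f : ℂ → ℂ) : Prop where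
  holo : DifferentiableOn ℂ f unitDisc
  mapsTo : Set.MapsTo f unitDisc unitDisc
  map_zero : f 0 = 0
  deriv_im : (deriv f 0).im = 0
  deriv_re_pos : 0 < (deriv f 0).re

/-- `f` is typically real on the unit disc. -/
def IsTypicallyReal (f : ℂ → ℂ) : Prop :=
  ∀ z ∈ unitDisc, 0 ≤ (f z).im * z.im

/-- The Taylor coefficients of `f` at the origin are all real. -/
def HasRealCoefficients (f : ℂ → ℂ) : Prop :=
  ∀ n : ℕ, (iteratedDeriv n f 0 / (n.factorial : ℂ)).im = 0

/-- The class `𝒯` of bounded typically real maps. -/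
def classT : Set (ℂ → ℂ) :=
  {f | IsNormalizedSelfMap f ∧ IsTypicallyReal f}

/-- The class `𝒰` of univalent self-maps with real coefficients. -/
def classU : Set (ℂ → ℂ) :=
  {f | IsNormalizedSelfMap f ∧ Set.InjOn f unitDisc ∧ HasRealCoefficients f}

/-- The value set `V_A(z₀) = {f(z₀) | f ∈ A}`. -/
def valueSet (A : Set (ℂ → ℂ)) (z₀ : ℂ) : Set ℂ :=
  {w | ∃ f ∈ A, f z₀ = w}

/-- The map `f_{1,t}`. For `t ≥ 0` and `z` in the disc the radicand `e^t (z+1)^2 - 4 z` avoids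
`(-∞, 0]`, so the principal branch of the square root is the holomorphic one with value `e^(t/2)`
at `z = 0`. At `z = 0` the formula returns `0` (division by zero), which is the value of the
removable singularity. -/
def slitMap₁ (t : ℝ) (z : ℂ) : ℂ :=
  1 / (2 * z) * ((Real.exp t : ℂ) * (z + 1) ^ 2 - 2 * z
    - (Real.exp (t / 2) : ℂ) * (z + 1)
      * ((Real.exp t : ℂ) * (z + 1) ^ 2 - 4 * z) ^ (1 / 2 : ℂ))

/-- The map `f_{2,t}`, with the same conventions: `f_{2,t}(z) = -f_{1,t}(-z)`. -/
def slitMap₂ (t : ℝ) (z : ℂ) : ℂ :=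
  1 / (2 * z) * ((Real.exp t : ℂ) * (z - 1) ^ 2 + 2 * z
    + (Real.exp (t / 2) : ℂ) * (z - 1)
      * ((Real.exp t : ℂ) * (z - 1) ^ 2 + 4 * z) ^ (1 / 2 : ℂ))

end

open Complex Filter Topology

/-! Everything is read off from the quotient `koebe (f z) / koebe z`. On the unit circle `1 / koebe
z = 2 + 2 Re z` is real and nonnegative, and on the real diameter all values are real, so the
maximum principle on a half disc shows that for `f` in `classT` the imaginary part of the quotient
has the sign of `Im z` (`koebeQuotient_im_nonneg`). The same holds for `-f (-z)`.

With `u = 1 / koebe z₀` and `W = 1 / koebe (f z₀)`, the two inequalities confine `W` to a cone with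
vertex `u`. Conversely `slitMap₁ t` acts by `W ↦ e^t W` (`koebe_slitMap₁`) and `slitMap₂ s` by `4 -
W ↦ e^s (4 - W)`, so compositions of the two, which lie in `classU`, fill the cone
(`valueRegion_subset`).

At a nonzero boundary point one inequality is an equality. By the open mapping theorem the quotient
is then constant (`koebe_comp_eq_of_im_eq_zero`), and injectivity of `koebe` identifies `f` with a
slit map. For real `z₀`, monotonicity on the diameter and the Schwarz lemma suffice. -/

/-- The Koebe-type function `z / (1 + z) ^ 2`. -/
noncomputable def koebe (z : ℂ) : ℂ := z / (1 + z) ^ 2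

/-- The function `koebe (f z) / koebe z`, with its removable singularity at `0` filled in. -/
noncomputable def koebeQuotient (f : ℂ → ℂ) (z : ℂ) : ℂ :=
  dslope f 0 z * (1 + z) ^ 2 / (1 + f z) ^ 2

/-! ### The disc and the Koebe-type function. -/

lemma mem_unitDisc {z : ℂ} : z ∈ unitDisc ↔ ‖z‖ < 1 := by
  simp [unitDisc]

lemma zero_mem_unitDisc : (0 : ℂ) ∈ unitDisc := by simp [mem_unitDisc]

lemma isOpen_unitDisc : IsOpen unitDisc := Metric.isOpen_ball

lemma isPreconnected_unitDisc : IsPreconnected unitDisc :=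
  (convex_ball (0 : ℂ) 1).isPreconnected

lemma unitDisc_mem_nhds_zero : unitDisc ∈ 𝓝 (0 : ℂ) :=
  isOpen_unitDisc.mem_nhds zero_mem_unitDisc

lemma neg_mem_unitDisc {z : ℂ} (hz : z ∈ unitDisc) : -z ∈ unitDisc := by
  simpa [mem_unitDisc] using hz

lemma conj_mem_unitDisc {z : ℂ} (hz : z ∈ unitDisc) : (starRingEnd ℂ) z ∈ unitDisc := by
  simpa [mem_unitDisc] using hz

lemma one_add_ne_zero_of_mem {z : ℂ} (hz : z ∈ unitDisc) : 1 + z ≠ 0 := by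
  intro h
  have : z = -1 := by linear_combination h
  simp [mem_unitDisc, this] at hz

lemma normSq_lt_one_of_mem {z : ℂ} (hz : z ∈ unitDisc) : z.re ^ 2 + z.im ^ 2 < 1 := by
  have h := mem_unitDisc.1 hz
  have h2 : ‖z‖ ^ 2 = z.re ^ 2 + z.im ^ 2 := by
    rw [← normSq_eq_norm_sq, normSq_apply]; ring
  nlinarith [norm_nonneg z]

lemma koebe_injOn : Set.InjOn koebe unitDisc := by
  intro a ha b hb h
  have ha' := one_add_ne_zero_of_mem ha
  have hb' := one_add_ne_zero_of_mem hb
  unfold koebe at h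
  rw [div_eq_div_iff (pow_ne_zero 2 ha') (pow_ne_zero 2 hb')] at h
  have h2 : (a - b) * (1 - a * b) = 0 := by linear_combination h
  rcases mul_eq_zero.1 h2 with h3 | h3
  · exact sub_eq_zero.1 h3
  · exfalso
    have h4 : ‖a * b‖ = 1 := by rw [← sub_eq_zero.1 h3]; simp
    rw [norm_mul] at h4
    have := mem_unitDisc.1 ha
    have := mem_unitDisc.1 hb
    nlinarith [norm_nonneg a, norm_nonneg b]

lemma koebe_im (z : ℂ) :
    (koebe z).im = z.im * ((1 - (z.re ^ 2 + z.im ^ 2)) / normSq ((1 + z) ^ 2)) := by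
  simp only [koebe, div_im, sq, mul_re, mul_im, add_re, add_im, one_re, one_im]
  ring

lemma mul_koebe_im_nonneg {z : ℂ} (hz : z ∈ unitDisc) {s : ℝ} (h : 0 ≤ s * z.im) :
    0 ≤ s * (koebe z).im := by
  rw [koebe_im, ← mul_assoc]
  have := normSq_lt_one_of_mem hz
  have := normSq_nonneg ((1 + z) ^ 2)
  exact mul_nonneg h (div_nonneg (by linarith) this)

/-! ### Real values on the diameter and the Koebe quotient. -/

lemma IsTypicallyReal.im_eq_zero {f : ℂ → ℂ} (ht : IsTypicallyReal f)
    (hf : DifferentiableOn ℂ f unitDisc) {z : ℂ} (hz : z ∈ unitDisc) (him : z.im = 0) :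
    (f z).im = 0 := by
  have hc : ContinuousAt f z := hf.continuousOn.continuousAt (isOpen_unitDisc.mem_nhds hz)
  -- The sign of `s` chooses the side from which `z` is approached vertically; the two sides give
  -- opposite inequalities.
  have key : ∀ s : ℝ, s ≠ 0 → 0 ≤ s * (f z).im := by
    intro s hs
    have hφ : Tendsto (fun y : ℝ => z + (s * y : ℝ) * I) (𝓝[>] 0) (𝓝 z) := by
      have : Continuous fun y : ℝ => z + (s * y : ℝ) * I := by fun_prop
      have h := this.tendsto 0
      simp only [mul_zero, ofReal_zero, zero_mul, add_zero] at h
      exact h.mono_left nhdsWithin_le_nhds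
    have h1 : Tendsto (fun y : ℝ => s * (f (z + (s * y : ℝ) * I)).im) (𝓝[>] 0)
        (𝓝 (s * (f z).im)) :=
      tendsto_const_nhds.mul ((continuous_im.tendsto _).comp (hc.tendsto.comp hφ))
    refine ge_of_tendsto h1 ?_
    filter_upwards [hφ.eventually (isOpen_unitDisc.mem_nhds hz), self_mem_nhdsWithin] with y hy hy0
    have h2 := ht _ hy
    have h3 : (z + (s * y : ℝ) * I).im = s * y := by simp [him]
    rw [h3] at h2
    have hy0 : 0 < y := hy0
    by_contra hcon
    push Not at hcon
    nlinarith
  have h1 := key 1 one_ne_zero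
  have h2 := key (-1) (by norm_num)
  linarith

lemma dslope_mul_self {f : ℂ → ℂ} (h0 : f 0 = 0) (z : ℂ) : dslope f 0 z * z = f z := by
  have := sub_smul_dslope f 0 z
  simp [h0] at this
  rw [mul_comm]; exact this

lemma IsNormalizedSelfMap.differentiableOn_dslope {f : ℂ → ℂ} (hf : IsNormalizedSelfMap f) :
    DifferentiableOn ℂ (dslope f 0) unitDisc :=
  (Complex.differentiableOn_dslope unitDisc_mem_nhds_zero).2 hf.holo

lemma koebeQuotient_mul_koebe {f : ℂ → ℂ} (h0 : f 0 = 0) {z : ℂ} (hz : z ∈ unitDisc) :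
    koebeQuotient f z * koebe z = koebe (f z) := by
  have := one_add_ne_zero_of_mem hz
  rw [koebeQuotient, koebe, koebe, ← dslope_mul_self h0 z]
  field_simp

lemma koebeQuotient_zero {f : ℂ → ℂ} (h0 : f 0 = 0) : koebeQuotient f 0 = deriv f 0 := by
  simp [koebeQuotient, h0]

lemma IsNormalizedSelfMap.differentiableOn_koebeQuotient {f : ℂ → ℂ}
    (hf : IsNormalizedSelfMap f) : DifferentiableOn ℂ (koebeQuotient f) unitDisc := by
  refine (hf.differentiableOn_dslope.mul (by fun_prop)).div
    ((hf.holo.const_add 1).pow 2) fun z hz => pow_ne_zero 2 (one_add_ne_zero_of_mem (hf.mapsTo hz))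

lemma dslope_im_eq_zero {f : ℂ → ℂ} (hf : f ∈ classT) {z : ℂ} (hz : z ∈ unitDisc)
    (him : z.im = 0) : (dslope f 0 z).im = 0 := by
  by_cases h : z = 0
  · subst h; simpa using hf.1.deriv_im
  · have h1 := dslope_mul_self hf.1.map_zero z
    have h2 := hf.2.im_eq_zero hf.1.holo hz him
    have hre : z.re ≠ 0 := fun h' => h (Complex.ext h' him)
    rw [← h1, mul_im, him] at h2
    simpa [hre] using h2

lemma one_add_sq_of_norm_eq_one {z : ℂ} (hz : ‖z‖ = 1) :
    (1 + z) ^ 2 = ((2 + 2 * z.re : ℝ) : ℂ) * z := by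
  have h1 : z * (starRingEnd ℂ) z = 1 := by rw [mul_conj, normSq_eq_norm_sq, hz]; simp
  have h2 := add_conj z
  push_cast at h2 ⊢
  linear_combination z * h2 - h1

/-! ### The Koebe inequality. -/

/-- The maximum principle on a half disc, applied to a dilation of a map in `𝒯`. -/
lemma koebeQuotient_dilation_im_nonneg {f : ℂ → ℂ} (hf : f ∈ classT) {r : ℝ} (hr0 : 0 < r)
    (hr1 : r < 1) {z₀ : ℂ} (hz₀ : z₀ ∈ unitDisc) (him : z₀.im ≠ 0) :
    0 ≤ z₀.im * (r * dslope f 0 (r * z₀) * (1 + z₀) ^ 2 / (1 + f (r * z₀)) ^ 2).im := by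
  set σ := z₀.im with hσ
  set U : Set ℂ := {z | ‖z‖ < 1 ∧ 0 < σ * z.im} with hU
  -- This is `koebe (f (r z)) / koebe z` with its singularity removed. As `r < 1`, it is holomorphic
  -- near the closed disc, so boundary values exist.
  set H : ℂ → ℂ := fun z => r * dslope f 0 (r * z) * (1 + z) ^ 2 / (1 + f (r * z)) ^ 2 with hH
  have hUo : IsOpen U :=
    (isOpen_lt continuous_norm continuous_const).inter
      (isOpen_lt continuous_const (continuous_const.mul continuous_im))
  have hUc : closure U ⊆ {z | ‖z‖ ≤ 1 ∧ 0 ≤ σ * z.im} := by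
    refine closure_minimal (fun z hz => ⟨hz.1.le, hz.2.le⟩) ?_
    exact (isClosed_le continuous_norm continuous_const).inter
      (isClosed_le continuous_const (continuous_const.mul continuous_im))
  have hr : ∀ z : ℂ, ‖z‖ ≤ 1 → (r : ℂ) * z ∈ unitDisc := by
    intro z hz
    rw [mem_unitDisc, norm_mul, norm_real, Real.norm_of_nonneg hr0.le]
    nlinarith [norm_nonneg z]
  have hd : ∀ z : ℂ, ‖z‖ ≤ 1 → DifferentiableAt ℂ H z := by
    intro z hz
    have hm := isOpen_unitDisc.mem_nhds (hr z hz)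
    have hl : DifferentiableAt ℂ (fun z : ℂ => (r : ℂ) * z) z := by fun_prop
    have h1 : DifferentiableAt ℂ (fun z => f (r * z)) z :=
      (hf.1.holo.differentiableAt hm).comp z hl
    have h2 : DifferentiableAt ℂ (fun z => dslope f 0 (r * z)) z :=
      (hf.1.differentiableOn_dslope.differentiableAt hm).comp z hl
    exact ((h2.const_mul _).mul (by fun_prop)).div ((h1.const_add 1).pow 2)
      (pow_ne_zero 2 (one_add_ne_zero_of_mem (hf.1.mapsTo (hr z hz))))
  have hbd : ∀ z ∈ frontier U, 0 ≤ σ * (H z).im := by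
    intro z hz
    obtain ⟨hz1, hz2⟩ := hUc (frontier_subset_closure hz)
    have hzU : z ∉ U := by
      have := hz.2
      rwa [hUo.interior_eq] at this
    have hrz := hr z hz1
    have hrim : ((r : ℂ) * z).im = r * z.im := by simp
    by_cases hn : ‖z‖ = 1
    · have hv : H z = koebe (f (r * z)) * ((2 + 2 * z.re : ℝ) : ℂ) := by
        have := dslope_mul_self hf.1.map_zero (r * z)
        simp only [hH, koebe]
        rw [one_add_sq_of_norm_eq_one hn]
        nth_rewrite 2 [← this]
        ring
      rw [hv, im_mul_ofReal, ← mul_assoc]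
      have hre : -1 ≤ z.re := by
        have := abs_re_le_norm z
        rw [hn] at this
        exact (abs_le.1 this).1
      refine mul_nonneg (mul_koebe_im_nonneg (hf.1.mapsTo hrz) ?_) (by linarith)
      by_cases hz0 : z.im = 0
      · rw [hf.2.im_eq_zero hf.1.holo hrz (by simp [hz0]), mul_zero]
      · have h3 := hf.2 _ hrz
        rw [hrim] at h3
        have h4 : 0 < z.im ^ 2 := by positivity
        have h5 : 0 ≤ (σ * (f (r * z)).im) * (r * z.im ^ 2) := by
          have := mul_nonneg hz2 h3
          nlinarith
        exact nonneg_of_mul_nonneg_left h5 (by positivity)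
    · have hz0 : z.im = 0 := by
        by_contra h0
        refine hzU ⟨lt_of_le_of_ne hz1 hn, lt_of_le_of_ne hz2 ?_⟩
        exact (mul_ne_zero him h0).symm
      have h1 : (dslope f 0 (r * z)).im = 0 := dslope_im_eq_zero hf hrz (by simp [hz0])
      have h2 : (f (r * z)).im = 0 := hf.2.im_eq_zero hf.1.holo hrz (by simp [hz0])
      have e1 : dslope f 0 (r * z) = ((dslope f 0 (r * z)).re : ℂ) := Complex.ext rfl (by simp [h1])
      have e2 : f (r * z) = ((f (r * z)).re : ℂ) := Complex.ext rfl (by simp [h2])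
      have e3 : z = (z.re : ℂ) := Complex.ext rfl (by simp [hz0])
      have e4 : H z = ((r * (dslope f 0 (r * z)).re * (1 + z.re) ^ 2 /
          (1 + (f (r * z)).re) ^ 2 : ℝ) : ℂ) := by
        simp only [hH]
        rw [e1, e2]
        push_cast
        rw [← e3]
        simp only [ofReal_re]
      rw [e4, ofReal_im, mul_zero]
  -- Exponentiating turns the sign of a harmonic function into a norm bound by `1`, the form needed
  -- for the maximum modulus principle.
  have hn : ∀ w : ℂ, ‖cexp (I * σ * w)‖ = Real.exp (-(σ * w.im)) := by
    intro w
    rw [norm_exp]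
    congr 1
    simp
  have hmem : z₀ ∈ U := ⟨mem_unitDisc.1 hz₀, mul_self_pos.2 him⟩
  have hb : Bornology.IsBounded U :=
    Metric.isBounded_ball.subset (fun z hz => mem_unitDisc.2 hz.1 : U ⊆ Metric.ball (0 : ℂ) 1)
  have hdc : DiffContOnCl ℂ (fun z => cexp (I * σ * H z)) U := by
    refine DifferentiableOn.diffContOnCl fun z hz => ?_
    exact ((hd z (hUc hz).1).const_mul _).cexp.differentiableWithinAt
  have := norm_le_of_forall_mem_frontier_norm_le hb hdc (C := 1) (fun z hz => by
    rw [hn]; simpa using hbd z hz) (subset_closure hmem)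
  rw [hn] at this
  simpa using this

lemma koebeQuotient_im_nonneg {f : ℂ → ℂ} (hf : f ∈ classT) {z : ℂ} (hz : z ∈ unitDisc) :
    0 ≤ (koebeQuotient f z).im * z.im := by
  by_cases him : z.im = 0
  · rw [him, mul_zero]
  have hl : Tendsto (fun r : ℝ => (r : ℂ) * z) (𝓝[<] 1) (𝓝 z) := by
    have : Continuous fun r : ℝ => (r : ℂ) * z := by fun_prop
    have h := this.tendsto 1
    simp only [ofReal_one, one_mul] at h
    exact h.mono_left nhdsWithin_le_nhds
  have hl1 : Tendsto (fun r : ℝ => (r : ℂ)) (𝓝[<] 1) (𝓝 1) := by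
    have h := continuous_ofReal.tendsto 1
    rw [ofReal_one] at h
    exact h.mono_left nhdsWithin_le_nhds
  have hm := isOpen_unitDisc.mem_nhds hz
  have h1 := (hf.1.holo.continuousOn.continuousAt hm).tendsto.comp hl
  have h2 := (hf.1.differentiableOn_dslope.continuousOn.continuousAt hm).tendsto.comp hl
  have h3 := ((hl1.mul h2).mul_const ((1 + z) ^ 2)).div ((h1.const_add 1).pow 2)
    (pow_ne_zero 2 (one_add_ne_zero_of_mem (hf.1.mapsTo hz)))
  have h4 := ((continuous_im.tendsto _).comp h3).const_mul z.im
  have h5 := ge_of_tendsto (b := 0) h4 (by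
    filter_upwards [Ioo_mem_nhdsLT (zero_lt_one (α := ℝ))] with r hr
    exact koebeQuotient_dilation_im_nonneg hf hr.1 hr.2 hz him)
  rw [mul_comm]
  simpa [koebeQuotient] using h5

/-! ### Rigidity in the case of equality. -/

/-- A holomorphic function on the disc whose imaginary part has the sign of `Im z` is constant as
soon as it takes a real value at a non-real point. -/
lemma eq_const_of_im_eq_zero {h : ℂ → ℂ} (hd : DifferentiableOn ℂ h unitDisc)
    (hpos : ∀ z ∈ unitDisc, 0 ≤ (h z).im * z.im) {z₀ : ℂ} (hz₀ : z₀ ∈ unitDisc)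
    (him : z₀.im ≠ 0) (h0 : (h z₀).im = 0) : ∀ z ∈ unitDisc, h z = h 0 := by
  set U : Set ℂ := unitDisc ∩ {z | 0 < z₀.im * z.im} with hU
  have hUo : IsOpen U := isOpen_unitDisc.inter
      (isOpen_lt continuous_const (continuous_const.mul continuous_im))
  have hUc : IsPreconnected U := by
    refine ((convex_ball (0 : ℂ) 1).inter ?_).isPreconnected
    intro a ha b hb s t hs ht hst
    simp only [Set.mem_ofPred_eq, add_im, real_smul, im_ofReal_mul] at *
    rcases hs.eq_or_lt with rfl | hs
    · have : t = 1 := by linarith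
      subst this; simpa using hb
    · have h1 := mul_pos hs ha
      have h2 := mul_nonneg ht hb.le
      nlinarith
  have ha : AnalyticOnNhd ℂ h unitDisc := hd.analyticOnNhd isOpen_unitDisc
  have hmem : z₀ ∈ U := ⟨hz₀, mul_self_pos.2 him⟩
  rcases (ha.mono Set.inter_subset_left).is_constant_or_isOpen hUc with ⟨w, hw⟩ | ho
  · have heq : Set.EqOn h (fun _ => w) unitDisc :=
      ha.eqOn_of_preconnected_of_eventuallyEq analyticOnNhd_const isPreconnected_unitDisc hz₀
        (by filter_upwards [hUo.mem_nhds hmem] with z hz using hw z hz)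
    intro z hz
    rw [heq hz, heq zero_mem_unitDisc]
  -- If `h` is open, the real value `h z₀` is interior to the image of the half disc, which then
  -- contains values with imaginary part of the wrong sign.
  · exfalso
    have hop := ho U subset_rfl hUo
    have hn := hop.mem_nhds (Set.mem_image_of_mem h hmem)
    have hl : Tendsto (fun y : ℝ => h z₀ - (z₀.im * y : ℝ) * I) (𝓝[>] 0) (𝓝 (h z₀)) := by
      have : Continuous fun y : ℝ => h z₀ - (z₀.im * y : ℝ) * I := by fun_prop
      have h := this.tendsto 0
      simp only [mul_zero, ofReal_zero, zero_mul, sub_zero] at h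
      exact h.mono_left nhdsWithin_le_nhds
    obtain ⟨y, ⟨z, hz, hzy⟩, hy⟩ := ((hl.eventually hn).and self_mem_nhdsWithin).exists
    have hy : 0 < y := hy
    have h1 := hpos z hz.1
    have h2 : 0 < z₀.im * z.im := hz.2
    have h3 : (h z).im = -(z₀.im * y) := by rw [hzy]; simp [h0]
    rw [h3] at h1
    nlinarith [mul_pos h2 hy]

lemma im_ne_zero_of_mem_classT {f : ℂ → ℂ} (hf : f ∈ classT) {z : ℂ} (hz : z ∈ unitDisc)
    (him : z.im ≠ 0) : (f z).im ≠ 0 := by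
  intro h
  have hc := eq_const_of_im_eq_zero hf.1.holo hf.2 hz him h
  have h1 : f =ᶠ[𝓝 0] fun _ => f 0 := by
    filter_upwards [unitDisc_mem_nhds_zero] with z hz using hc z hz
  have h2 := hf.1.deriv_re_pos
  rw [h1.deriv_eq] at h2
  simp at h2

/-- Rigidity: equality in the Koebe inequality at one non-real point. -/
lemma koebe_comp_eq_of_im_eq_zero {f : ℂ → ℂ} (hf : f ∈ classT) {z₀ : ℂ} (hz₀ : z₀ ∈ unitDisc)
    (him : z₀.im ≠ 0) (h : (koebe (f z₀) / koebe z₀).im = 0) :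
    ∃ t : ℝ, 0 ≤ t ∧ ∀ z ∈ unitDisc, koebe (f z) = Real.exp (-t) * koebe z := by
  have hk0 : koebe z₀ ≠ 0 := by
    have : z₀ ≠ 0 := by rintro rfl; simp at him
    exact div_ne_zero this (pow_ne_zero 2 (one_add_ne_zero_of_mem hz₀))
  rw [← koebeQuotient_mul_koebe hf.1.map_zero hz₀, mul_div_cancel_right₀ _ hk0] at h
  have hc := eq_const_of_im_eq_zero hf.1.differentiableOn_koebeQuotient
    (fun z hz => koebeQuotient_im_nonneg hf hz) hz₀ him h
  rw [koebeQuotient_zero hf.1.map_zero] at hc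
  have hpos := hf.1.deriv_re_pos
  have hreal : deriv f 0 = ((deriv f 0).re : ℂ) := Complex.ext rfl (by simp [hf.1.deriv_im])
  -- The Schwarz lemma; this makes `t = -log f'(0)` nonnegative.
  have hle : (deriv f 0).re ≤ 1 := by
    refine (re_le_norm _).trans (norm_deriv_le_one_of_mapsTo_ball hf.1.holo ?_ one_pos)
    rw [hf.1.map_zero]
    exact hf.1.mapsTo.mono_right Metric.ball_subset_closedBall
  refine ⟨-Real.log (deriv f 0).re, by linarith [Real.log_nonpos hpos.le hle], fun z hz => ?_⟩
  rw [neg_neg, Real.exp_log hpos, ← hreal, ← hc z hz, koebeQuotient_mul_koebe hf.1.map_zero hz]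

/-! ### Real coefficients, conjugation symmetry, and the inclusion of classes. -/

lemma iteratedDeriv_conj_conj (f : ℂ → ℂ) (n : ℕ) :
    iteratedDeriv n (starRingEnd ℂ ∘ f ∘ starRingEnd ℂ) =
      starRingEnd ℂ ∘ iteratedDeriv n f ∘ starRingEnd ℂ := by
  induction n with
  | zero => simp
  | succ n ih => rw [iteratedDeriv_succ, iteratedDeriv_succ, ih, deriv_conj_conj]

lemma hasRealCoefficients_of_conj {f : ℂ → ℂ}
    (h : ∀ z ∈ unitDisc, f ((starRingEnd ℂ) z) = (starRingEnd ℂ) (f z)) :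
    HasRealCoefficients f := by
  intro n
  have h1 : (starRingEnd ℂ ∘ f ∘ starRingEnd ℂ) =ᶠ[𝓝 0] f := by
    filter_upwards [unitDisc_mem_nhds_zero] with z hz
    simp [h z hz]
  have h2 := h1.iteratedDeriv_eq n
  rw [iteratedDeriv_conj_conj] at h2
  simp only [Function.comp_apply, map_zero] at h2
  rw [← conj_eq_iff_im, map_div₀, h2]
  simp

lemma HasRealCoefficients.conj_eq {f : ℂ → ℂ} (hr : HasRealCoefficients f)
    (hf : DifferentiableOn ℂ f unitDisc) {z : ℂ} (hz : z ∈ unitDisc) :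
    f ((starRingEnd ℂ) z) = (starRingEnd ℂ) (f z) := by
  have h1 := hasSum_taylorSeries_on_ball hf (conj_mem_unitDisc hz)
  have h2 := (hasSum_conj' ).2 (hasSum_taylorSeries_on_ball hf hz)
  have hn : ∀ n, (starRingEnd ℂ) (iteratedDeriv n f 0) = iteratedDeriv n f 0 := by
    intro n
    have := conj_eq_iff_im.2 (hr n)
    rw [map_div₀, map_natCast] at this
    exact (div_left_inj' (Nat.cast_ne_zero.2 n.factorial_ne_zero)).1 this
  simp only [smul_eq_mul, map_mul, map_inv₀, map_natCast, map_pow, sub_zero, hn] at h1 h2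
  exact h1.unique h2

/-- Links `f'` on the real axis with the sign of `Im f` just off the axis. -/
lemma hasDerivAt_im_vertical {f : ℂ → ℂ} {z : ℂ} (hf : DifferentiableAt ℂ f z) :
    HasDerivAt (fun y : ℝ => (f (z + y * I)).im) (deriv f z).re 0 := by
  have h1 : HasDerivAt (fun y : ℝ => z + (y : ℂ) * I) I 0 := by
    simpa using ((ofRealCLM.hasDerivAt (x := (0 : ℝ))).mul_const I).const_add z
  have h2 : HasDerivAt (fun y : ℝ => f (z + y * I)) (deriv f z * I) 0 :=
    HasDerivAt.comp (0 : ℝ) (by simpa using hf.hasDerivAt) h1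
  have h3 := (imCLM.hasFDerivAt (x := f (z + (0 : ℝ) * I))).comp_hasDerivAt (0 : ℝ) h2
  have e : imCLM (deriv f z * I) = (deriv f z).re := by simp
  rw [e] at h3
  exact h3

/-- If `f z` is real, symmetry gives `f z̄ = f z`, so `z` is real by injectivity. Hence `Im f` has
constant sign on the upper half disc, and `f'(0) > 0` makes it positive near `0`. -/
lemma classU_subset_classT : classU ⊆ classT := by
  rintro f ⟨hf, hinj, hr⟩
  refine ⟨hf, ?_⟩
  have hc := fun z hz => hr.conj_eq hf.holo (z := z) hz
  set U : Set ℂ := unitDisc ∩ {z | 0 < z.im} with hU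
  have hne : ∀ z ∈ U, (f z).im ≠ 0 := by
    rintro z ⟨hz, hz'⟩ h
    have h1 := hc z hz
    rw [conj_eq_iff_im.2 h] at h1
    have h2 := hinj (conj_mem_unitDisc hz) hz h1
    exact (ne_of_gt hz') (conj_eq_iff_im.1 h2)
  have hUc : IsPreconnected U :=
    ((convex_ball (0 : ℂ) 1).inter (convex_halfSpace_im_gt 0)).isPreconnected
  obtain ⟨y, hy, hyU⟩ : ∃ w ∈ U, 0 < (f w).im := by
    have him := hasDerivAt_im_vertical (hf.holo.differentiableAt unitDisc_mem_nhds_zero)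
    simp only [zero_add] at him
    have hs := (hasDerivAt_iff_tendsto_slope.1 him).eventually (lt_mem_nhds hf.deriv_re_pos)
    have hs' : ∀ᶠ y : ℝ in 𝓝[>] 0, 0 < slope (fun y : ℝ => (f (y * I)).im) 0 y :=
      hs.filter_mono (nhdsWithin_mono _ fun y hy => ne_of_gt hy)
    obtain ⟨y, hy1, hy2, hy3⟩ := (hs'.and (Ioo_mem_nhdsGT (zero_lt_one (α := ℝ)))).exists
    refine ⟨y * I, ⟨?_, by simpa using hy2⟩, ?_⟩
    · rw [mem_unitDisc]
      simpa [abs_of_pos hy2] using hy3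
    · simp only [slope_def_field, ofReal_zero, zero_mul, hf.map_zero, zero_im, sub_zero] at hy1
      exact (div_pos_iff_of_pos_right hy2).1 hy1
  have hpos : ∀ z ∈ U, 0 < (f z).im := by
    intro z hz
    by_contra hcon
    have hcont : ContinuousOn (fun z => (f z).im) U :=
      continuous_im.comp_continuousOn (hf.holo.continuousOn.mono Set.inter_subset_left)
    obtain ⟨w, hw, hw0⟩ := hUc.intermediate_value hz hy hcont ⟨not_lt.1 hcon, hyU.le⟩
    exact hne w hw hw0
  intro z hz
  rcases lt_trichotomy z.im 0 with h | h | h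
  · have h1 := hpos ((starRingEnd ℂ) z) ⟨conj_mem_unitDisc hz, by simpa using h⟩
    rw [hc z hz, conj_im] at h1
    nlinarith
  · rw [h, mul_zero]
  · exact (mul_pos (hpos z ⟨hz, h⟩) h).le

/-! ### Stability under rotation and composition. -/

/-- Conjugation of a map with the rotation `z ↦ -z`. -/
def negConj (f : ℂ → ℂ) (z : ℂ) : ℂ := -f (-z)

lemma IsNormalizedSelfMap.negConj {f : ℂ → ℂ} (hf : IsNormalizedSelfMap f) :
    IsNormalizedSelfMap (negConj f) := by
  have hd : deriv (_root_.negConj f) 0 = deriv f 0 := by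
    have : _root_.negConj f = -(fun z => f (-z)) := rfl
    rw [this, deriv.neg, deriv_comp_neg]
    simp
  refine ⟨?_, fun z hz => neg_mem_unitDisc (hf.mapsTo (neg_mem_unitDisc hz)), ?_, ?_, ?_⟩
  · exact (hf.holo.comp (differentiableOn_neg _) fun z hz => neg_mem_unitDisc hz).neg
  · simp [_root_.negConj, hf.map_zero]
  · rw [hd, hf.deriv_im]
  · rw [hd]; exact hf.deriv_re_pos

lemma negConj_mem_classT {f : ℂ → ℂ} (hf : f ∈ classT) : negConj f ∈ classT := by
  refine ⟨hf.1.negConj, fun z hz => ?_⟩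
  have := hf.2 (-z) (neg_mem_unitDisc hz)
  simpa [negConj] using this

lemma negConj_mem_classU {f : ℂ → ℂ} (hf : f ∈ classU) : negConj f ∈ classU := by
  refine ⟨hf.1.negConj, fun a ha b hb h => ?_, hasRealCoefficients_of_conj fun z hz => ?_⟩
  · exact neg_injective
      (hf.2.1 (neg_mem_unitDisc ha) (neg_mem_unitDisc hb) (neg_injective h))
  · have := hf.2.2.conj_eq hf.1.holo (neg_mem_unitDisc hz)
    simpa [negConj] using this

lemma comp_mem_classU {f g : ℂ → ℂ} (hf : f ∈ classU) (hg : g ∈ classU) : f ∘ g ∈ classU := by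
  have hd : deriv (f ∘ g) 0 = ((deriv f 0).re * (deriv g 0).re : ℝ) := by
    rw [deriv_comp 0 (by rw [hg.1.map_zero]; exact hf.1.holo.differentiableAt unitDisc_mem_nhds_zero)
      (hg.1.holo.differentiableAt unitDisc_mem_nhds_zero), hg.1.map_zero, ofReal_mul]
    congr 1
    · exact Complex.ext rfl (by simp [hf.1.deriv_im])
    · exact Complex.ext rfl (by simp [hg.1.deriv_im])
  refine ⟨⟨hf.1.holo.comp hg.1.holo hg.1.mapsTo, hf.1.mapsTo.comp hg.1.mapsTo, ?_, ?_, ?_⟩,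
    hf.2.1.comp hg.2.1 hg.1.mapsTo, hasRealCoefficients_of_conj fun z hz => ?_⟩
  · simp [hf.1.map_zero, hg.1.map_zero]
  · rw [hd, ofReal_im]
  · rw [hd, ofReal_re]; exact mul_pos hf.1.deriv_re_pos hg.1.deriv_re_pos
  · simp only [Function.comp_apply]
    rw [hg.2.2.conj_eq hg.1.holo hz, hf.2.2.conj_eq hf.1.holo (hg.1.mapsTo hz)]

/-! ### The slit maps. -/

/-- The radicand in the formula for the slit map. -/
noncomputable def slitRadicand (t : ℝ) (z : ℂ) : ℂ := (Real.exp t : ℂ) * (z + 1) ^ 2 - 4 * z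

/-- Write `p = e^(t/2) (z + 1)` and `s` for the root. Then `(p - s)(p + s) = 4z` and the slit map is
`(p - s)² / (4z) = 4z / (p + s)²`, which is regular at `0`. -/
noncomputable def slitDenominator (t : ℝ) (z : ℂ) : ℂ :=
  (Real.exp (t / 2) : ℂ) * (z + 1) + slitRadicand t z ^ (1 / 2 : ℂ)

/-- With `z = a + bi` and `E = e^t`, a real radicand forces `b = 0`, where it is at least `(1 -
a)²`, or `E (a + 1) = 2`, where `b² < 1 - a²` makes it positive. -/
lemma slitRadicand_mem_slitPlane {t : ℝ} (ht : 0 ≤ t) {z : ℂ} (hz : z ∈ unitDisc) :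
    slitRadicand t z ∈ slitPlane := by
  rw [mem_slitPlane_iff]
  by_contra! hcon
  obtain ⟨h1, h2⟩ := hcon
  have hE : 1 ≤ Real.exp t := Real.one_le_exp ht
  set E := Real.exp t
  have hn := normSq_lt_one_of_mem hz
  set a := z.re
  set b := z.im
  have hre : (slitRadicand t z).re = E * ((a + 1) ^ 2 - b ^ 2) - 4 * a := by
    simp [slitRadicand, sq, E, a, b, -ofReal_exp]
  have him : (slitRadicand t z).im = b * (2 * E * (a + 1) - 4) := by
    simp [slitRadicand, sq, E, a, b, -ofReal_exp]; ring
  rw [hre] at h1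
  rw [him] at h2
  rcases mul_eq_zero.1 h2 with hb | hb
  · rw [hb] at h1 hn
    have ha : a < 1 := by nlinarith
    nlinarith [mul_nonneg (sub_nonneg.2 hE) (sq_nonneg (a + 1)), sq_pos_of_pos (sub_pos.2 ha)]
  · have hEa : E * (a + 1) = 2 := by linarith
    have h3 : E * b ^ 2 < E * (1 - a ^ 2) := by nlinarith
    nlinarith

lemma slitRoot_sq (t : ℝ) (z : ℂ) :
    (slitRadicand t z ^ (1 / 2 : ℂ)) ^ 2 = (Real.exp (t / 2) * (z + 1)) ^ 2 - 4 * z := by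
  have h1 : (slitRadicand t z ^ (1 / 2 : ℂ)) ^ 2 = slitRadicand t z := by
    rw [one_div]; exact cpow_ofNat_inv_pow _ 2
  rw [h1, slitRadicand, mul_pow, ← ofReal_pow, ← Real.exp_nat_mul]
  congr 4
  push_cast; ring_nf

lemma slitRoot_zero (t : ℝ) : slitRadicand t 0 ^ (1 / 2 : ℂ) = Real.exp (t / 2) := by
  have : slitRadicand t 0 = (Real.exp t : ℂ) := by simp [slitRadicand]
  rw [this, Real.exp_half, Real.sqrt_eq_rpow, ofReal_cpow (Real.exp_pos t).le]
  simp

/-- A zero would give `s = -p`, hence `z = 0`; but there the principal root is `+p`. -/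
lemma slitDenominator_ne_zero (t : ℝ) (z : ℂ) : slitDenominator t z ≠ 0 := by
  intro h
  have h1 := slitRoot_sq t z
  unfold slitDenominator at h
  have hz : z = 0 := by
    linear_combination (1 / 4) * h1 + (1 / 4) * (Real.exp (t / 2) * (z + 1) -
      slitRadicand t z ^ (1 / 2 : ℂ)) * h
  rw [hz, slitRoot_zero] at h
  have : (Real.exp (t / 2) : ℂ) ≠ 0 := ofReal_ne_zero.2 (Real.exp_pos _).ne'
  apply this
  linear_combination h / 2

lemma slitMap₁_eq (t : ℝ) (z : ℂ) : slitMap₁ t z = 4 * z / slitDenominator t z ^ 2 := by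
  have h1 := slitRoot_sq t z
  have h2 := slitDenominator_ne_zero t z
  have h3 : (Real.exp t : ℂ) = Real.exp (t / 2) ^ 2 := by
    rw [← ofReal_pow, ← Real.exp_nat_mul]; congr 2; push_cast; ring
  by_cases hz : z = 0
  · simp [slitMap₁, hz]
  rw [eq_div_iff (pow_ne_zero 2 h2), slitMap₁, h3]
  change 1 / (2 * z) * (Real.exp (t / 2) ^ 2 * (z + 1) ^ 2 - 2 * z -
    Real.exp (t / 2) * (z + 1) * (((Real.exp (t / 2) : ℂ) ^ 2 * (z + 1) ^ 2 - 4 * z) ^ (1 / 2 : ℂ)))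
      * slitDenominator t z ^ 2 = 4 * z
  have h4 : (Real.exp (t / 2) : ℂ) ^ 2 * (z + 1) ^ 2 - 4 * z = slitRadicand t z := by
    rw [slitRadicand, h3]
  rw [h4, slitDenominator]
  generalize slitRadicand t z ^ (1 / 2 : ℂ) = s at h1 ⊢
  generalize (Real.exp (t / 2) : ℂ) = p at h1 ⊢
  field_simp
  have h5 : (p * (z + 1)) ^ 2 - 2 * z - p * (z + 1) * s = (p * (z + 1) - s) ^ 2 / 2 := by
    linear_combination (-1 / 2) * h1
  have h6 : (p * (z + 1) - s) * (p * (z + 1) + s) = 4 * z := by linear_combination -h1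
  have h7 : ((p * (z + 1)) ^ 2 - 2 * z - p * (z + 1) * s) * (p * (z + 1) + s) ^ 2 = 8 * z ^ 2 := by
    rw [h5]
    linear_combination (1 / 2) * ((p * (z + 1) - s) * (p * (z + 1) + s) + 4 * z) * h6
  linear_combination h7

lemma one_add_slitMap₁_mul (t : ℝ) (z : ℂ) :
    (1 + slitMap₁ t z) * slitDenominator t z = 2 * (Real.exp (t / 2) * (z + 1)) := by
  have h1 := slitRoot_sq t z
  have h2 := slitDenominator_ne_zero t z
  rw [slitMap₁_eq]
  field_simp
  rw [slitDenominator]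
  linear_combination h1

lemma koebe_slitMap₁ (t : ℝ) {z : ℂ} (hz : z ∈ unitDisc) :
    koebe (slitMap₁ t z) = Real.exp (-t) * koebe z := by
  have h1 := one_add_slitMap₁_mul t z
  have h2 := slitDenominator_ne_zero t z
  have h3 := one_add_ne_zero_of_mem hz
  have h4 : (Real.exp (t / 2) : ℂ) ≠ 0 := ofReal_ne_zero.2 (Real.exp_pos _).ne'
  have h5 : (Real.exp (-t) : ℂ) * Real.exp (t / 2) ^ 2 = 1 := by
    rw [← ofReal_pow, ← Real.exp_nat_mul, ← ofReal_mul, ← Real.exp_add]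
    have : -t + ((2 : ℕ) : ℝ) * (t / 2) = 0 := by push_cast; ring
    rw [this, Real.exp_zero, ofReal_one]
  have h6 : 1 + slitMap₁ t z ≠ 0 := by
    intro h
    rw [h, zero_mul] at h1
    exact mul_ne_zero two_ne_zero (mul_ne_zero h4 (by rwa [add_comm])) h1.symm
  have h7 : slitMap₁ t z * slitDenominator t z ^ 2 = 4 * z := by
    rw [slitMap₁_eq]; field_simp
  rw [koebe, koebe, mul_div_assoc', div_eq_div_iff (pow_ne_zero 2 h6) (pow_ne_zero 2 h3)]
  apply mul_right_cancel₀ (pow_ne_zero 2 h2)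
  have h8 : (1 + slitMap₁ t z) ^ 2 * slitDenominator t z ^ 2 =
      4 * (Real.exp (t / 2) ^ 2 * (z + 1) ^ 2) := by
    rw [← mul_pow, h1]; ring
  linear_combination (1 + z) ^ 2 * h7 - Real.exp (-t) * z * h8 - 4 * z * (z + 1) ^ 2 * h5

lemma differentiableAt_slitMap₁ {t : ℝ} (ht : 0 ≤ t) {z : ℂ} (hz : z ∈ unitDisc) :
    DifferentiableAt ℂ (slitMap₁ t) z := by
  have : slitMap₁ t = fun z => 4 * z / slitDenominator t z ^ 2 := funext (slitMap₁_eq t)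
  rw [this]
  have h1 : DifferentiableAt ℂ (slitRadicand t) z := by
    unfold slitRadicand; fun_prop
  have h2 : DifferentiableAt ℂ (slitDenominator t) z := by
    unfold slitDenominator
    exact DifferentiableAt.add (by fun_prop)
      (h1.cpow_const (slitRadicand_mem_slitPlane ht hz))
  exact DifferentiableAt.div (by fun_prop) (h2.pow 2) (pow_ne_zero 2 (slitDenominator_ne_zero t z))

lemma slitMap₁_zero (t : ℝ) : slitMap₁ t 0 = 0 := by simp [slitMap₁]

lemma deriv_slitMap₁_zero {t : ℝ} (ht : 0 ≤ t) : deriv (slitMap₁ t) 0 = Real.exp (-t) := by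
  have h1 : (fun z => koebe (slitMap₁ t z)) =ᶠ[𝓝 0] fun z => Real.exp (-t) * koebe z := by
    filter_upwards [unitDisc_mem_nhds_zero] with z hz using koebe_slitMap₁ t hz
  have hk : HasDerivAt koebe 1 0 := by
    have h := ((hasDerivAt_id (0 : ℂ)).const_add 1).pow 2
    have h2 := (hasDerivAt_id (0 : ℂ)).div h (by simp)
    simp only [id_eq, Pi.pow_apply, add_zero, one_pow, mul_one, zero_mul, sub_zero, div_one] at h2
    exact h2
  have hs := (differentiableAt_slitMap₁ ht zero_mem_unitDisc).hasDerivAt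
  have hc : HasDerivAt (fun z => koebe (slitMap₁ t z)) (1 * deriv (slitMap₁ t) 0) 0 :=
    HasDerivAt.comp (h₂ := koebe) (0 : ℂ) (by rwa [slitMap₁_zero]) hs
  have h2 := (hk.const_mul (Real.exp (-t) : ℂ)).congr_of_eventuallyEq h1
  simpa using hc.unique h2

lemma slitMap₁_conj {t : ℝ} (ht : 0 ≤ t) {z : ℂ} (hz : z ∈ unitDisc) :
    slitMap₁ t ((starRingEnd ℂ) z) = (starRingEnd ℂ) (slitMap₁ t z) := by
  have h1 : slitRadicand t ((starRingEnd ℂ) z) = (starRingEnd ℂ) (slitRadicand t z) := by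
    simp [slitRadicand, -ofReal_exp, conj_ofNat]
  have h2 : (slitRadicand t z).arg ≠ Real.pi := (mem_slitPlane_iff_arg.1
    (slitRadicand_mem_slitPlane ht hz)).1
  have h3 : slitDenominator t ((starRingEnd ℂ) z) = (starRingEnd ℂ) (slitDenominator t z) := by
    rw [slitDenominator, slitDenominator, h1, conj_cpow _ _ h2]
    simp [-ofReal_exp, conj_ofNat]
  rw [slitMap₁_eq, slitMap₁_eq, h3]
  simp [conj_ofNat]

/-- A value `v` on the circle would give `(1 + z)² = c z` with `c = e^(-t) (2 + 2 Re v)` in `[0,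
4]`, and such an equation has all its roots on the circle. -/
lemma norm_slitMap₁_ne_one {t : ℝ} (ht : 0 ≤ t) {z : ℂ} (hz : z ∈ unitDisc) :
    ‖slitMap₁ t z‖ ≠ 1 := by
  intro h
  have hz0 : z ≠ 0 := by
    rintro rfl
    simp [slitMap₁_zero] at h
  have hk := koebe_slitMap₁ t hz
  generalize slitMap₁ t z = v at h hk
  have hv0 : v ≠ 0 := by rintro rfl; simp at h
  have hz1 := one_add_ne_zero_of_mem hz
  have hE : (Real.exp (-t) : ℂ) ≠ 0 := ofReal_ne_zero.2 (Real.exp_pos _).ne'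
  have hk0 : koebe z ≠ 0 := div_ne_zero hz0 (pow_ne_zero 2 hz1)
  have hv1 : (1 + v) ^ 2 ≠ 0 := by
    intro h0
    rw [koebe, h0, div_zero] at hk
    exact mul_ne_zero hE hk0 hk.symm
  have hre := re_le_norm v
  have hre' := (abs_le.1 (abs_re_le_norm v)).1
  rw [h] at hre hre'
  obtain ⟨c, hc0, hc4, hc⟩ : ∃ c : ℝ, 0 ≤ c ∧ c ≤ 4 ∧ (1 + z) ^ 2 = c * z := by
    refine ⟨Real.exp (-t) * (2 + 2 * v.re),
      mul_nonneg (Real.exp_pos _).le (by linarith), ?_, ?_⟩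
    · have h1 : Real.exp (-t) ≤ 1 := Real.exp_le_one_iff.2 (by linarith)
      have h2 := (Real.exp_pos (-t)).le
      nlinarith
    · rw [koebe, koebe, mul_div_assoc', div_eq_div_iff hv1 (pow_ne_zero 2 hz1),
        one_add_sq_of_norm_eq_one h] at hk
      apply mul_left_cancel₀ hv0
      rw [hk, ofReal_mul]
      ring
  have hn := normSq_lt_one_of_mem hz
  have e1 := congrArg re hc
  have e2 := congrArg im hc
  simp only [sq, mul_re, mul_im, add_re, add_im, one_re, one_im, ofReal_re, ofReal_im] at e1 e2
  by_cases hb : z.im = 0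
  · rw [hb] at e1 hn
    have ha1 : z.re < 1 := by nlinarith
    have ha2 : -1 < z.re := by nlinarith
    rcases le_total 0 z.re with ha | ha
    · nlinarith [mul_le_mul_of_nonneg_right hc4 ha, sq_pos_of_pos (sub_pos.2 ha1)]
    · nlinarith [mul_nonneg hc0 (neg_nonneg.2 ha), sq_pos_of_pos (sub_pos.2 ha2)]
  · have hc' : c = 2 * (1 + z.re) := by
      apply mul_right_cancel₀ hb
      linarith
    rw [hc'] at e1
    nlinarith

lemma slitMap₁_mem_classU {t : ℝ} (ht : 0 ≤ t) : slitMap₁ t ∈ classU := by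
  have hd : DifferentiableOn ℂ (slitMap₁ t) unitDisc := fun z hz =>
    (differentiableAt_slitMap₁ ht hz).differentiableWithinAt
  have hm : Set.MapsTo (slitMap₁ t) unitDisc unitDisc := by
    intro z hz
    by_contra hcon
    rw [mem_unitDisc, not_lt] at hcon
    -- The modulus starts at `0` and never equals `1`, so it stays below `1`.
    obtain ⟨w, hw, hw1⟩ := isPreconnected_unitDisc.intermediate_value zero_mem_unitDisc hz
      hd.continuousOn.norm (show (1 : ℝ) ∈ Set.Icc _ _ from ⟨by simp [slitMap₁_zero], hcon⟩)
    exact norm_slitMap₁_ne_one ht hw hw1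
  refine ⟨⟨hd, hm, slitMap₁_zero t, ?_, ?_⟩, fun a ha b hb h => ?_,
    hasRealCoefficients_of_conj fun z hz => slitMap₁_conj ht hz⟩
  · rw [deriv_slitMap₁_zero ht, ofReal_im]
  · rw [deriv_slitMap₁_zero ht, ofReal_re]; exact Real.exp_pos _
  · have h1 := koebe_slitMap₁ t ha
    rw [h, koebe_slitMap₁ t hb] at h1
    exact (koebe_injOn hb ha (mul_left_cancel₀ (ofReal_ne_zero.2 (Real.exp_pos _).ne') h1)).symm

lemma slitMap₂_eq_negConj (t : ℝ) : slitMap₂ t = negConj (slitMap₁ t) := by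
  funext z
  simp only [slitMap₂, negConj, slitMap₁]
  have h1 : (Real.exp t : ℂ) * (-z + 1) ^ 2 - 4 * -z = (Real.exp t : ℂ) * (z - 1) ^ 2 + 4 * z := by
    ring
  rw [h1]
  by_cases hz : z = 0
  · simp [hz]
  field_simp
  ring

/-! ### The value region at a non-real point as a cone. -/

lemma koebe_ne_zero {z : ℂ} (hz : z ∈ unitDisc) (h0 : z ≠ 0) : koebe z ≠ 0 :=
  div_ne_zero h0 (pow_ne_zero 2 (one_add_ne_zero_of_mem hz))

/-- In the coordinate `1 / koebe` the rotation becomes affine, so both slit families act affinely.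
-/
lemma inv_koebe_neg {z : ℂ} (h0 : z ≠ 0) : (koebe (-z))⁻¹ = 4 - (koebe z)⁻¹ := by
  rw [koebe, koebe, inv_div, inv_div]
  field_simp
  ring

lemma inv_koebe_im_mul_neg {z : ℂ} (hz : z ∈ unitDisc) (him : z.im ≠ 0) :
    ((koebe z)⁻¹).im * z.im < 0 := by
  have h0 : z ≠ 0 := by rintro rfl; simp at him
  have h1 := normSq_pos.2 (koebe_ne_zero hz h0)
  have h2 := normSq_pos.2 (pow_ne_zero 2 (one_add_ne_zero_of_mem hz))
  have h3 := normSq_lt_one_of_mem hz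
  have h4 : 0 < z.im ^ 2 := by positivity
  rw [inv_im, koebe_im]
  have h5 : 0 < z.im ^ 2 * ((1 - (z.re ^ 2 + z.im ^ 2)) / normSq ((1 + z) ^ 2)) /
      normSq (koebe z) := by
    have : 0 < 1 - (z.re ^ 2 + z.im ^ 2) := by linarith
    positivity
  calc _ = -(z.im ^ 2 * ((1 - (z.re ^ 2 + z.im ^ 2)) / normSq ((1 + z) ^ 2)) /
      normSq (koebe z)) := by ring
    _ < 0 := by linarith

lemma inv_div_inv_im (u W : ℂ) : (W⁻¹ / u⁻¹).im = (u.im * W.re - u.re * W.im) / normSq W := by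
  have : W⁻¹ / u⁻¹ = u / W := by rw [div_inv_eq_mul]; ring
  rw [this, div_im]
  ring

/-- Coordinates in the cone with vertex `u` spanned by `u` and `u - 4`. -/
lemma exists_cone_coordinates {u W : ℂ} {y : ℝ} (hu : u.im * y < 0) (hW : W ≠ 0) (hW4 : W ≠ 4)
    (h1 : 0 ≤ (W⁻¹ / u⁻¹).im * y) (h2 : 0 ≤ ((4 - W)⁻¹ / (4 - u)⁻¹).im * -y) :
    ∃ a b : ℝ, 0 ≤ a ∧ 0 ≤ b ∧ W = (1 + a) * u + b * (u - 4) := by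
  have hq : u.im ≠ 0 := by rintro h; simp [h] at hu
  have n1 := normSq_pos.2 hW
  have n2 := normSq_pos.2 (sub_ne_zero.2 hW4.symm)
  rw [inv_div_inv_im, div_mul_eq_mul_div, le_div_iff₀ n1, zero_mul] at h1
  rw [inv_div_inv_im, div_mul_eq_mul_div, le_div_iff₀ n2, zero_mul] at h2
  have e1 : (4 - u).im = -u.im := by simp
  have e2 : (4 - W).im = -W.im := by simp
  have e3 : (4 - u).re = 4 - u.re := by simp
  have e4 : (4 - W).re = 4 - W.re := by simp
  rw [e1, e2, e3, e4] at h2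
  have hy : 0 < y ^ 2 := by
    have : y ≠ 0 := by rintro rfl; simp at hu
    positivity
  -- Cramer's rule; `h2` controls the sign of the first numerator and `h1` that of the second.
  refine ⟨(u.im * (W.re - 4) - (u.re - 4) * W.im) / (4 * u.im),
    (u.re * W.im - u.im * W.re) / (4 * u.im), ?_, ?_, ?_⟩
  · have : (u.im * (W.re - 4) - (u.re - 4) * W.im) / (4 * u.im) =
      (-((u.im * (W.re - 4) - (u.re - 4) * W.im) * y)) / (4 * -(u.im * y)) := by
      have : y ≠ 0 := by rintro rfl; simp at hu
      field_simp
    rw [this]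
    apply div_nonneg <;> nlinarith
  · have : (u.re * W.im - u.im * W.re) / (4 * u.im) =
      (-((u.re * W.im - u.im * W.re) * y)) / (4 * -(u.im * y)) := by
      have : y ≠ 0 := by rintro rfl; simp at hu
      field_simp
    rw [this]
    apply div_nonneg <;> nlinarith
  · apply Complex.ext
    · simp only [add_re, mul_re, sub_re, add_im, one_re, one_im, ofReal_re, ofReal_im, sub_im,
        re_ofNat, im_ofNat]
      field_simp
      ring
    · simp only [mul_im, add_re, sub_re, add_im, one_re, one_im, ofReal_re, ofReal_im,
        sub_im, re_ofNat, im_ofNat]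
      field_simp
      ring

lemma map_ne_zero_of_mem_classU {f : ℂ → ℂ} (hf : f ∈ classU) {z : ℂ} (hz : z ∈ unitDisc)
    (h0 : z ≠ 0) : f z ≠ 0 := fun h =>
  h0 (hf.2.1 hz zero_mem_unitDisc (h.trans hf.1.map_zero.symm))

/-- The value region of both classes at a non-real point. -/
def valueRegion (z₀ : ℂ) : Set ℂ :=
  -- The origin must be excluded by hand: it satisfies both inequalities trivially.
  {w | w ∈ unitDisc ∧ w ≠ 0 ∧ 0 ≤ (koebe w / koebe z₀).im * z₀.im ∧
    0 ≤ (koebe (-w) / koebe (-z₀)).im * (-z₀).im}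

lemma valueRegion_subset {z₀ : ℂ} (hz₀ : z₀ ∈ unitDisc) (him : z₀.im ≠ 0) :
    valueRegion z₀ ⊆ valueSet classU z₀ := by
  rintro w ⟨hw, hw0, h1, h2⟩
  have hz0 : z₀ ≠ 0 := by rintro rfl; simp at him
  have hk := inv_koebe_neg hz0
  have hkw := inv_koebe_neg hw0
  have hkw' := koebe_ne_zero (neg_mem_unitDisc hw) (neg_ne_zero.2 hw0)
  obtain ⟨a, b, ha, hb, hab⟩ := exists_cone_coordinates (inv_koebe_im_mul_neg hz₀ him)
    (inv_ne_zero (koebe_ne_zero hw hw0))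
    (fun h => inv_ne_zero hkw' (by rw [hkw, h, sub_self])) (by simpa only [inv_inv] using h1)
    (by rw [← hk, ← hkw, inv_inv, inv_inv]; simpa using h2)
  have hb1 : 0 < 1 + b := by linarith
  have hab1 : 1 ≤ (1 + a + b) / (1 + b) := by rw [le_div_iff₀ hb1]; linarith
  -- Solves `4 - e^s (4 - e^t u) = (1 + a) u + b (u - 4)` for `s` and `t`.
  set s := Real.log (1 + b)
  set t := Real.log ((1 + a + b) / (1 + b))
  have hs : 0 ≤ s := Real.log_nonneg (by linarith)
  have ht : 0 ≤ t := Real.log_nonneg hab1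
  have hes : Real.exp s = 1 + b := Real.exp_log hb1
  have het : Real.exp t = (1 + a + b) / (1 + b) := Real.exp_log (by linarith)
  have hg := slitMap₁_mem_classU ht
  have hgz := hg.1.mapsTo hz₀
  have hf := comp_mem_classU (negConj_mem_classU (slitMap₁_mem_classU hs)) hg
  refine ⟨_, hf, ?_⟩
  apply neg_injective
  refine koebe_injOn (neg_mem_unitDisc (hf.1.mapsTo hz₀)) (neg_mem_unitDisc hw) ?_
  simp only [Function.comp_apply, negConj, neg_neg]
  apply inv_injective
  rw [koebe_slitMap₁ s (neg_mem_unitDisc hgz), mul_inv,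
    inv_koebe_neg (map_ne_zero_of_mem_classU hg hz₀ hz0), koebe_slitMap₁ t hz₀, mul_inv,
    ← ofReal_inv, ← ofReal_inv, Real.exp_neg, Real.exp_neg, inv_inv, inv_inv, hes, het, hkw, hab]
  have : (1 + b : ℂ) ≠ 0 := by exact_mod_cast hb1.ne'
  push_cast
  field_simp
  ring

lemma mem_valueRegion_of_mem_classT {f : ℂ → ℂ} (hf : f ∈ classT) {z₀ : ℂ} (hz₀ : z₀ ∈ unitDisc)
    (him : z₀.im ≠ 0) : f z₀ ∈ valueRegion z₀ := by
  have key : ∀ {g : ℂ → ℂ}, g ∈ classT → ∀ z ∈ unitDisc, z.im ≠ 0 →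
      0 ≤ (koebe (g z) / koebe z).im * z.im := by
    intro g hg z hz hzi
    have hz0 : z ≠ 0 := by rintro rfl; simp at hzi
    rw [← koebeQuotient_mul_koebe hg.1.map_zero hz, mul_div_cancel_right₀ _ (koebe_ne_zero hz hz0)]
    exact koebeQuotient_im_nonneg hg hz
  refine ⟨hf.1.mapsTo hz₀, fun h => ?_, key hf _ hz₀ him, ?_⟩
  · apply im_ne_zero_of_mem_classT hf hz₀ him
    rw [h, zero_im]
  · have := key (negConj_mem_classT hf) (-z₀) (neg_mem_unitDisc hz₀) (by simpa using him)
    simpa only [negConj, neg_neg] using this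

lemma valueSet_eq_valueRegion {z₀ : ℂ} (hz₀ : z₀ ∈ unitDisc) (him : z₀.im ≠ 0) :
    valueSet classT z₀ = valueRegion z₀ := by
  refine Set.Subset.antisymm ?_ fun w hw => ?_
  · rintro _ ⟨f, hf, rfl⟩
    exact mem_valueRegion_of_mem_classT hf hz₀ him
  · obtain ⟨f, hf, h⟩ := valueRegion_subset hz₀ him hw
    exact ⟨f, classU_subset_classT hf, h⟩

/-! ### Real points. -/

/-- Typical reality makes `Im f (y + is) / s` nonnegative, so `f' ≥ 0` on the diameter and `f` is
monotone there; `f'(0) > 0` gives strictness just right of `0`. -/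
lemma re_pos_of_mem_classT {f : ℂ → ℂ} (hf : f ∈ classT) {x : ℝ} (hx0 : 0 < x) (hx1 : x < 1) :
    0 < (f x).re := by
  have hmem : ∀ y ∈ Set.Ioo (-1 : ℝ) 1, (y : ℂ) ∈ unitDisc := fun y hy => by
    rw [mem_unitDisc, norm_real, Real.norm_eq_abs, abs_lt]
    exact hy
  have hd : ∀ y ∈ Set.Ioo (-1 : ℝ) 1, HasDerivAt (fun y : ℝ => (f y).re) (deriv f y).re y :=
    fun y hy => HasDerivAt.real_of_complex
      (hf.1.holo.differentiableAt (isOpen_unitDisc.mem_nhds (hmem y hy))).hasDerivAt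
  have hnn : ∀ y ∈ Set.Ioo (-1 : ℝ) 1, 0 ≤ (deriv f y).re := by
    intro y hy
    have hm := isOpen_unitDisc.mem_nhds (hmem y hy)
    have h1 := hasDerivAt_iff_tendsto_slope.1
      (hasDerivAt_im_vertical (hf.1.holo.differentiableAt hm))
    refine ge_of_tendsto h1 ?_
    have hl : Tendsto (fun s : ℝ => (y : ℂ) + s * I) (𝓝[≠] 0) (𝓝 (y : ℂ)) := by
      have : Continuous fun s : ℝ => (y : ℂ) + s * I := by fun_prop
      have h := this.tendsto 0
      simp only [ofReal_zero, zero_mul, add_zero] at h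
      exact h.mono_left nhdsWithin_le_nhds
    filter_upwards [hl.eventually hm, self_mem_nhdsWithin] with s hs hs0
    have hs0 : s ≠ 0 := hs0
    have h2 := hf.2 _ hs
    have h3 := hf.2.im_eq_zero hf.1.holo (hmem y hy) (ofReal_im y)
    have h4 : ((y : ℂ) + s * I).im = s := by simp
    rw [h4] at h2
    simp only [slope_def_field, ofReal_zero, zero_mul, add_zero, h3, sub_zero]
    have h5 : (f (y + s * I)).im / s = (f (y + s * I)).im * s / s ^ 2 := by field_simp
    rw [h5]
    positivity
  have hmono : MonotoneOn (fun y : ℝ => (f y).re) (Set.Ioo (-1) 1) := by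
    refine monotoneOn_of_deriv_nonneg (convex_Ioo _ _)
      (fun y hy => (hd y hy).continuousAt.continuousWithinAt) ?_ ?_
    · rw [interior_Ioo]
      exact fun y hy => (hd y hy).differentiableAt.differentiableWithinAt
    · rw [interior_Ioo]
      intro y hy
      rw [(hd y hy).deriv]
      exact hnn y hy
  have h0 := hd 0 (by norm_num)
  rw [ofReal_zero] at h0
  have hs := (hasDerivAt_iff_tendsto_slope.1 h0).eventually (lt_mem_nhds hf.1.deriv_re_pos)
  have hs' := hs.filter_mono (nhdsWithin_mono (0 : ℝ) (s := Set.Ioi 0) fun y hy => ne_of_gt hy)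
  obtain ⟨y, hy1, hy2, hy3⟩ := (hs'.and (Ioo_mem_nhdsGT hx0)).exists
  simp only [slope_def_field, ofReal_zero, hf.1.map_zero, zero_re, sub_zero] at hy1
  have hy4 := (div_pos_iff_of_pos_right hy2).1 hy1
  exact hy4.trans_le (hmono ⟨by linarith, by linarith⟩ ⟨by linarith, hx1⟩ hy3.le)

lemma re_mul_pos_of_mem_classT {f : ℂ → ℂ} (hf : f ∈ classT) {x : ℝ} (hx : |x| < 1)
    (h0 : x ≠ 0) : 0 < x * (f x).re := by
  obtain ⟨h1, h2⟩ := abs_lt.1 hx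
  rcases lt_or_gt_of_ne h0 with h | h
  · have := re_pos_of_mem_classT (negConj_mem_classT hf) (x := -x) (by linarith) (by linarith)
    simp only [negConj, ofReal_neg, neg_neg, neg_re] at this
    nlinarith
  · exact mul_pos h (re_pos_of_mem_classT hf h h2)

lemma exists_slitMap₁_eq_ofReal {x y : ℝ} (hx : |x| < 1) (hxy : 0 < x * y) (hle : |y| ≤ |x|) :
    ∃ t : ℝ, 0 ≤ t ∧ slitMap₁ t x = y := by
  have hxd : (x : ℂ) ∈ unitDisc := by rwa [mem_unitDisc, norm_real]
  have hyd : (y : ℂ) ∈ unitDisc := by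
    rw [mem_unitDisc, norm_real]; exact hle.trans_lt hx
  obtain ⟨hx1, hx2⟩ := abs_lt.1 hx
  obtain ⟨hy1, hy2⟩ := abs_lt.1 (hle.trans_lt hx)
  have hx0 : x ≠ 0 := by rintro rfl; simp at hxy
  have p1 : 0 < (1 + x) ^ 2 := by have : 0 < 1 + x := by linarith
                                  positivity
  have p2 : 0 < (1 + y) ^ 2 := by have : 0 < 1 + y := by linarith
                                  positivity
  have p3 : 0 < x ^ 2 := by positivity
  have hsq : x * y ≤ x ^ 2 := by
    rw [← abs_of_pos hxy, abs_mul, ← sq_abs x]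
    nlinarith [abs_nonneg x]
  -- The fraction is `koebe y / koebe x`, the forced value of `e^(-t)`. Denominator minus numerator
  -- is `(x² - xy)(1 - xy)`.
  have hle1 : x * y * (1 + x) ^ 2 / (x ^ 2 * (1 + y) ^ 2) ≤ 1 := by
    rw [div_le_one (by positivity)]
    have hxy1 : x * y < 1 := by nlinarith
    nlinarith [mul_nonneg (sub_nonneg.2 hsq) (sub_nonneg.2 hxy1.le)]
  have hpos : 0 < x * y * (1 + x) ^ 2 / (x ^ 2 * (1 + y) ^ 2) := by positivity
  have ht : 0 ≤ -Real.log (x * y * (1 + x) ^ 2 / (x ^ 2 * (1 + y) ^ 2)) := by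
    linarith [Real.log_nonpos hpos.le hle1]
  refine ⟨_, ht, koebe_injOn ((slitMap₁_mem_classU ht).1.mapsTo hxd) hyd ?_⟩
  rw [koebe_slitMap₁ _ hxd, neg_neg, Real.exp_log hpos, koebe, koebe]
  have c1 := one_add_ne_zero_of_mem hxd
  have c2 := one_add_ne_zero_of_mem hyd
  have c3 : (x : ℂ) ≠ 0 := ofReal_ne_zero.2 hx0
  push_cast
  field_simp

lemma valueSet_subset_of_im_eq_zero {z₀ : ℂ} (hz₀ : z₀ ∈ unitDisc) (hne : z₀ ≠ 0)
    (him : z₀.im = 0) : valueSet classT z₀ ⊆ valueSet classU z₀ := by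
  rintro _ ⟨f, hf, rfl⟩
  obtain ⟨x, rfl⟩ : ∃ x : ℝ, (x : ℂ) = z₀ := ⟨z₀.re, Complex.ext rfl (by simp [him])⟩
  have hx : |x| < 1 := by simpa [mem_unitDisc] using hz₀
  obtain ⟨y, hy⟩ : ∃ y : ℝ, (y : ℂ) = f x :=
    ⟨(f x).re, Complex.ext rfl (by simp [hf.2.im_eq_zero hf.1.holo hz₀ him])⟩
  have hle : ‖f x‖ ≤ ‖(x : ℂ)‖ := norm_le_norm_of_mapsTo_ball hf.1.holo
    (hf.1.mapsTo.mono_right Metric.ball_subset_closedBall) hf.1.map_zero (mem_unitDisc.1 hz₀)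
  have hpos := re_mul_pos_of_mem_classT hf hx (ofReal_ne_zero.1 hne)
  rw [← hy, norm_real, norm_real] at hle
  rw [← hy, ofReal_re] at hpos
  obtain ⟨t, ht, h⟩ := exists_slitMap₁_eq_ofReal hx hpos hle
  exact ⟨_, slitMap₁_mem_classU ht, h.trans hy⟩

lemma valueSet_classT_eq_classU {z₀ : ℂ} (hz₀ : z₀ ∈ unitDisc) (hne : z₀ ≠ 0) :
    valueSet classT z₀ = valueSet classU z₀ := by
  refine Set.Subset.antisymm ?_ fun w ⟨f, hf, h⟩ => ⟨f, classU_subset_classT hf, h⟩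
  by_cases him : z₀.im = 0
  · exact valueSet_subset_of_im_eq_zero hz₀ hne him
  · rw [valueSet_eq_valueRegion hz₀ him]
    exact valueRegion_subset hz₀ him

/-! ### Boundary points and uniqueness. -/

lemma continuousAt_koebe {z : ℂ} (hz : z ∈ unitDisc) : ContinuousAt koebe z := by
  unfold koebe
  exact continuousAt_id.div (by fun_prop) (pow_ne_zero 2 (one_add_ne_zero_of_mem hz))

lemma mem_valueRegion_of_mem_frontier {z₀ : ℂ} (hz₀ : z₀ ∈ unitDisc) (him : z₀.im ≠ 0) {w : ℂ}
    (hw : w ∈ frontier (valueRegion z₀)) (hw0 : w ≠ 0) :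
    w ∈ valueRegion z₀ ∧ ((koebe w / koebe z₀).im = 0 ∨ (koebe (-w) / koebe (-z₀)).im = 0) := by
  -- The Schwarz lemma keeps the closure inside the open disc, where `koebe` is continuous.
  have hsub : valueRegion z₀ ⊆ Metric.closedBall 0 ‖z₀‖ := by
    rw [← valueSet_eq_valueRegion hz₀ him]
    rintro _ ⟨f, hf, rfl⟩
    rw [mem_closedBall_zero_iff]
    exact norm_le_norm_of_mapsTo_ball hf.1.holo
      (hf.1.mapsTo.mono_right Metric.ball_subset_closedBall) hf.1.map_zero (mem_unitDisc.1 hz₀)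
  have hwd : w ∈ unitDisc := by
    have := closure_minimal hsub Metric.isClosed_closedBall (frontier_subset_closure hw)
    rw [mem_closedBall_zero_iff] at this
    exact mem_unitDisc.2 (this.trans_lt (mem_unitDisc.1 hz₀))
  have hA : ContinuousAt (fun w => (koebe w / koebe z₀).im * z₀.im) w :=
    (continuous_im.continuousAt.comp ((continuousAt_koebe hwd).div_const _)).mul_const _
  have hB : ContinuousAt (fun w => (koebe (-w) / koebe (-z₀)).im * (-z₀).im) w := by
    have h1 : ContinuousAt (fun w => koebe (-w)) w :=
      ContinuousAt.comp (g := koebe) (continuousAt_koebe (neg_mem_unitDisc hwd))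
        continuousAt_neg
    exact (continuous_im.continuousAt.comp (h1.div_const _)).mul_const _
  have hfr := mem_closure_iff_frequently.1 (frontier_subset_closure hw)
  have hA0 : 0 ≤ (koebe w / koebe z₀).im * z₀.im := by
    by_contra hcon
    obtain ⟨v, hv, hv'⟩ := (hfr.and_eventually (hA.eventually_lt_const (not_le.1 hcon))).exists
    exact not_lt.2 hv.2.2.1 hv'
  have hB0 : 0 ≤ (koebe (-w) / koebe (-z₀)).im * (-z₀).im := by
    by_contra hcon
    obtain ⟨v, hv, hv'⟩ := (hfr.and_eventually (hB.eventually_lt_const (not_le.1 hcon))).exists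
    exact not_lt.2 hv.2.2.2 hv'
  refine ⟨⟨hwd, hw0, hA0, hB0⟩, ?_⟩
  by_contra! hcon
  have him' : (-z₀).im ≠ 0 := by simpa using him
  have hA1 := lt_of_le_of_ne hA0 (mul_ne_zero hcon.1 him).symm
  have hB1 := lt_of_le_of_ne hB0 (mul_ne_zero hcon.2 him').symm
  apply hw.2
  rw [mem_interior_iff_mem_nhds]
  filter_upwards [isOpen_unitDisc.mem_nhds hwd, isOpen_ne.mem_nhds hw0,
    hA.eventually_const_lt hA1, hB.eventually_const_lt hB1] with v h1 h2 h3 h4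
  exact ⟨h1, h2, h3.le, h4.le⟩

lemma eqOn_of_koebe_im_eq_zero {f : ℂ → ℂ} (hf : f ∈ classT) {z₀ : ℂ} (hz₀ : z₀ ∈ unitDisc)
    (him : z₀.im ≠ 0) (h : (koebe (f z₀) / koebe z₀).im = 0) :
    (∀ g ∈ classT, g z₀ = f z₀ → Set.EqOn g f unitDisc) ∧
      ∃ t : ℝ, 0 ≤ t ∧ Set.EqOn f (slitMap₁ t) unitDisc := by
  have hz0 : z₀ ≠ 0 := by rintro rfl; simp at him
  obtain ⟨t, ht, hkt⟩ := koebe_comp_eq_of_im_eq_zero hf hz₀ him h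
  refine ⟨fun g hg hgw z hz => ?_, t, ht, fun z hz => ?_⟩
  · obtain ⟨s, -, hks⟩ := koebe_comp_eq_of_im_eq_zero hg hz₀ him (by rw [hgw, h])
    have h1 := hks z₀ hz₀
    rw [hgw, hkt z₀ hz₀] at h1
    -- The value at `z₀` alone determines the factor `e^(-t)`.
    have h2 := mul_right_cancel₀ (koebe_ne_zero hz₀ hz0) h1
    apply koebe_injOn (hg.1.mapsTo hz) (hf.1.mapsTo hz)
    rw [hks z hz, hkt z hz, h2]
  · apply koebe_injOn (hf.1.mapsTo hz) ((slitMap₁_mem_classU ht).1.mapsTo hz)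
    rw [hkt z hz, koebe_slitMap₁ t hz]

theorem mainTheorem5 (z₀ : ℂ) (hz₀ : z₀ ∈ unitDisc) (hne : z₀ ≠ 0) :
    valueSet classT z₀ = valueSet classU z₀ ∧
    (z₀.im ≠ 0 →
      ∀ w ∈ frontier (valueSet classT z₀), w ≠ 0 →
        ∃ f ∈ classT, f z₀ = w ∧
          (∀ g ∈ classT, g z₀ = w → Set.EqOn g f unitDisc) ∧
          ∃ t : ℝ, 0 ≤ t ∧
            (Set.EqOn f (slitMap₁ t) unitDisc ∨ Set.EqOn f (slitMap₂ t) unitDisc)) := by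
  refine ⟨valueSet_classT_eq_classU hz₀ hne, fun him w hw hw0 => ?_⟩
  rw [valueSet_eq_valueRegion hz₀ him] at hw
  obtain ⟨hmem, hor⟩ := mem_valueRegion_of_mem_frontier hz₀ him hw hw0
  rw [← valueSet_eq_valueRegion hz₀ him] at hmem
  obtain ⟨f, hf, rfl⟩ := hmem
  refine ⟨f, hf, rfl, ?_⟩
  rcases hor with h | h
  · obtain ⟨huniq, t, ht, heq⟩ := eqOn_of_koebe_im_eq_zero hf hz₀ him h
    exact ⟨huniq, t, ht, Or.inl heq⟩
  -- The other edge of the cone is the first one for `-f (-z)` at `-z₀`, which exchanges the two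
  -- slit families.
  · obtain ⟨huniq, t, ht, heq⟩ := eqOn_of_koebe_im_eq_zero (negConj_mem_classT hf)
      (neg_mem_unitDisc hz₀) (by simpa using him) (by simpa only [negConj, neg_neg] using h)
    refine ⟨fun g hg hgw z hz => ?_, t, ht, Or.inr fun z hz => ?_⟩
    · have := huniq _ (negConj_mem_classT hg) (by simp [negConj, hgw]) (neg_mem_unitDisc hz)
      simpa [negConj] using this
    · have := heq (neg_mem_unitDisc hz)
      rw [slitMap₂_eq_negConj, negConj, ← this]
      simp [negConj]
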